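/- Let $\mathbb K$ be an algebraically closed field of characteristic $0$ and let $h,k,n\ge 0$ be integers with $n\ge (h+1)(k+1)-1$. By a subvariety of $\mathbb P^n=\mathbb P^n_{\mathbb K}$ we mean a Zariski-closed irreducible subset. For points $P=[a_0:\dots:a_n]$ and $Q=[b_0:\dots:b_n]$ of $\mathbb P^n$ the Hadamard product $P\odot Q=[a_0b_0:\dots:a_nb_n]$ is defined if some $a_ib_i\ne 0$, and for subvarieties $X,Y\subset\mathbb P^n$ the Hadamard product is the Zariski closure $$X\odot Y=\overline{\{P\odot Q : P\in X,\ Q\in Y,\ P\odot Q\text{ is defined}\}}.$$ Let $\sigma:\mathbb P^h\times\mathbb P^k\to\mathbb P^n$ be the Segre embedding $$\sigma([y_0:\dots:y_h],[z_0:\dots:z_k])=[y_0z_0:y_0z_1:\dots:y_0z_k:y_1z_0:\dots:y_hz_k:0:\dots:0].$$ There is a non-empty Zariski-open subset $U$ of the product of the Grassmannians of $h$-dimensional and of $k$-dimensional linear subspaces of $\mathbb P^n$ such that the following holds for all $(L_h,L_k)\in U$ (that is, for generic $L_h$ and $L_k$) and all subvarieties $X\subset L_h$ and $Y\subset L_k$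 of $\mathbb P^n$. 1. $X\odot Y$ and the product variety $X\times Y$ are projectively equivalent as subvarieties of $\mathbb P^n$: for all linear parameterizations $\varphi:\mathbb P^h\to L_h$ and $\psi:\mathbb P^k\to L_k$ (linear isomorphisms), $\sigma(\varphi^{-1}(X)\times\psi^{-1}(Y))$ and $X\odot Y$ are subvarieties of $\mathbb P^n$, and some projective automorphism of $\mathbb P^n$ maps the first onto the second. 2. $P\odot Q$ is defined for all $P\in X$ and $Q\in Y$, and $$X\odot Y=\{P\odot Q : P\in X,\ Q\in Y\}.$$ -/

import Mathlib

open scoped LinearAlgebra.Projectivization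

/-- Coordinate vectors of length `n + 1`. -/
abbrev Vec (K : Type*) (n : ℕ) : Type _ := Fin (n + 1) → K

/-- Projective `n`-space over `K`. -/
abbrev PSpace (K : Type*) [Field K] (n : ℕ) : Type _ := ℙ K (Vec K n)

section Zariski

variable {K : Type*} [Field K] {n : ℕ}

/-- The common zeros in projective space of a set of polynomials. It is only used for homogeneous
polynomials, for which vanishing does not depend on the representative of the point. -/
def projZeros (S : Set (MvPolynomial (Fin (n + 1)) K)) : Set (PSpace K n) :=
  {P | ∀ F ∈ S, MvPolynomial.eval P.rep F = 0}

/-- Algebraic subsets of projective space. -/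
def IsProjAlgebraic (Z : Set (PSpace K n)) : Prop :=
  ∃ S : Set (MvPolynomial (Fin (n + 1)) K),
    (∀ F ∈ S, ∃ d : ℕ, F.IsHomogeneous d) ∧ Z = projZeros S

theorem IsProjAlgebraic.empty : IsProjAlgebraic (∅ : Set (PSpace K n)) := by
  refine ⟨{1}, ?_, ?_⟩
  · rintro F rfl
    exact ⟨0, MvPolynomial.isHomogeneous_one _ _⟩
  · ext P
    simp [projZeros]

theorem IsProjAlgebraic.sInter (A : Set (Set (PSpace K n))) (hA : ∀ Z ∈ A, IsProjAlgebraic Z) :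
    IsProjAlgebraic (⋂₀ A) := by
  refine ⟨{F | (∃ d : ℕ, F.IsHomogeneous d) ∧ ∃ Z ∈ A, ∀ P ∈ Z, MvPolynomial.eval P.rep F = 0},
    fun F hF => hF.1, ?_⟩
  ext P
  constructor
  · rintro hP F ⟨-, Z, hZ, hF⟩
    exact hF P (hP Z hZ)
  · intro hP Z hZ
    obtain ⟨S, hS, rfl⟩ := hA Z hZ
    intro F hF
    exact hP F ⟨hS F hF, _, hZ, fun Q hQ => hQ F hF⟩

theorem IsProjAlgebraic.union (Z W : Set (PSpace K n)) (hZ : IsProjAlgebraic Z)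
    (hW : IsProjAlgebraic W) : IsProjAlgebraic (Z ∪ W) := by
  obtain ⟨S, hS, rfl⟩ := hZ
  obtain ⟨T, hT, rfl⟩ := hW
  refine ⟨Set.image2 (· * ·) S T, ?_, ?_⟩
  · rintro _ ⟨F, hF, G, hG, rfl⟩
    obtain ⟨d, hd⟩ := hS F hF
    obtain ⟨e, he⟩ := hT G hG
    exact ⟨d + e, hd.mul he⟩
  · ext P
    constructor
    · rintro (hP | hP) _ ⟨F, hF, G, hG, rfl⟩
      · simp [hP F hF]
      · simp [hP G hG]
    · intro hP
      by_contra hcon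
      simp only [Set.mem_union, not_or, projZeros, Set.mem_ofPred_eq, not_forall] at hcon
      obtain ⟨⟨F, hF, hF0⟩, G, hG, hG0⟩ := hcon
      have h := hP _ ⟨F, hF, G, hG, rfl⟩
      simp only [map_mul, mul_eq_zero] at h
      tauto

/-- The Zariski topology on projective space: the closed sets are the algebraic sets. -/
instance zariskiTopology : TopologicalSpace (PSpace K n) :=
  TopologicalSpace.ofClosed {Z | IsProjAlgebraic Z} IsProjAlgebraic.empty
    (fun A hA => IsProjAlgebraic.sInter A hA)
    (fun Z hZ W hW => IsProjAlgebraic.union Z W hZ hW)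

/-- A subvariety of projective space: a Zariski-closed irreducible (so non-empty) subset. -/
def IsSubvariety (Z : Set (PSpace K n)) : Prop :=
  IsClosed Z ∧ IsIrreducible Z

/-- `Z` and `W` are projectively equivalent as subvarieties of projective space: both are
subvarieties, and some projective automorphism maps `Z` onto `W`. -/
def ProjectivelyEquivalent (Z W : Set (PSpace K n)) : Prop :=
  IsSubvariety Z ∧ IsSubvariety W ∧
    ∃ g : Vec K n ≃ₗ[K] Vec K n,
      Projectivization.map (g : Vec K n →ₗ[K] Vec K n) g.injective '' Z = W

end Zariski

section Hadamard

variable {K : Type*} [Field K] {n : ℕ}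

/-- The Hadamard product of `P` and `Q` is defined if the coordinatewise product of coordinate
vectors of `P` and `Q` is not the zero vector. -/
def HadamardDefined (P Q : PSpace K n) : Prop := P.rep * Q.rep ≠ 0

/-- The Hadamard product `[a₀ b₀ : … : aₙ bₙ]` of `[a₀ : … : aₙ]` and `[b₀ : … : bₙ]`. -/
noncomputable def hadamardPoint (P Q : PSpace K n) (h : HadamardDefined P Q) : PSpace K n :=
  Projectivization.mk K (P.rep * Q.rep) h

/-- The set of all (defined) products `P ⊙ Q` with `P ∈ X` and `Q ∈ Y`. -/
def hadamardPoints (X Y : Set (PSpace K n)) : Set (PSpace K n) :=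
  {R | ∃ P ∈ X, ∃ Q ∈ Y, ∃ h : HadamardDefined P Q, R = hadamardPoint P Q h}

/-- The Hadamard product `X ⊙ Y`: the Zariski closure of the set of all products `P ⊙ Q`. -/
def hadamardProduct (X Y : Set (PSpace K n)) : Set (PSpace K n) :=
  closure (hadamardPoints X Y)

end Hadamard

section Segre

variable {K : Type*} [Field K] {n h k : ℕ}

/-- The vector `(y₀z₀, y₀z₁, …, y₀zₖ, y₁z₀, …, yₕzₖ, 0, …, 0)` of length `n + 1`. -/
def segreVec (n : ℕ) (y : Vec K h) (z : Vec K k) : Vec K n := fun t =>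
  if ht : (t : ℕ) < (h + 1) * (k + 1) then
    y (finProdFinEquiv.symm ⟨t, ht⟩).1 * z (finProdFinEquiv.symm ⟨t, ht⟩).2
  else 0

theorem segreVec_ne_zero (hn : (h + 1) * (k + 1) ≤ n + 1) {y : Vec K h} {z : Vec K k}
    (hy : y ≠ 0) (hz : z ≠ 0) : segreVec n y z ≠ 0 := by
  obtain ⟨i, hi⟩ := Function.ne_iff.mp hy
  obtain ⟨j, hj⟩ := Function.ne_iff.mp hz
  intro h0
  have h1 := congrFun h0 ⟨finProdFinEquiv (i, j), (finProdFinEquiv (i, j)).2.trans_le hn⟩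
  simp only [segreVec, Fin.is_lt, dite_true, Fin.eta, Equiv.symm_apply_apply, Pi.zero_apply,
    mul_eq_zero] at h1
  exact h1.elim hi hj

/-- The Segre embedding of the product of projective `h`-space and projective `k`-space in
projective `n`-space, for `n ≥ (h + 1)(k + 1) - 1`. -/
noncomputable def segre (hn : (h + 1) * (k + 1) ≤ n + 1) (p : PSpace K h × PSpace K k) :
    PSpace K n :=
  Projectivization.mk K (segreVec n p.1.rep p.2.rep)
    (segreVec_ne_zero hn p.1.rep_nonzero p.2.rep_nonzero)

end Segre

section Generic

/-- The Grassmannian of `d`-dimensional linear subspaces of projective `n`-space, as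
`(d + 1)`-dimensional linear subspaces of the space of coordinate vectors. -/
abbrev Grass (K : Type*) [Field K] (n d : ℕ) : Type _ :=
  {L : Submodule K (Vec K n) // Module.finrank K L = d + 1}

variable {K : Type*} [Field K] {n h k : ℕ}

/-- The set of points of a linear subspace of projective space. -/
def Grass.points {d : ℕ} (L : Grass K n d) : Set (PSpace K n) := {P | P.submodule ≤ L.1}

/-- The linear subspace spanned by `d + 1` linearly independent vectors. -/
def Grass.ofFrame {d : ℕ} (a : Fin (d + 1) → Vec K n) (ha : LinearIndependent K a) :
    Grass K n d :=
  ⟨Submodule.span K (Set.range a), by simpa using finrank_span_eq_card ha⟩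

/-- Zariski-open subsets of the product of two Grassmannians. The Grassmannian has the quotient
topology from the variety of frames, so `U` is open if and only if the set of pairs of frames
which span a pair in `U` is open in the variety of pairs of frames, that is, it is the locus
where not all the polynomials of some set `S` in the entries of the two frames vanish. -/
def IsOpenInGrassProd (U : Set (Grass K n h × Grass K n k)) : Prop :=
  ∃ S : Set (MvPolynomial ((Fin (h + 1) × Fin (n + 1)) ⊕ (Fin (k + 1) × Fin (n + 1))) K),
    ∀ (a : Fin (h + 1) → Vec K n) (b : Fin (k + 1) → Vec K n)
      (ha : LinearIndependent K a) (hb : LinearIndependent K b),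
      (Grass.ofFrame a ha, Grass.ofFrame b hb) ∈ U ↔
        ∃ F ∈ S, MvPolynomial.eval (Sum.elim (fun s => a s.1 s.2) (fun s => b s.1 s.2)) F ≠ 0

/-- A property holds for generic pairs of linear subspaces of dimensions `h` and `k` of projective
`n`-space if it holds for all pairs in some non-empty Zariski-open set. -/
def ForGenericPair (p : Grass K n h → Grass K n k → Prop) : Prop :=
  ∃ U : Set (Grass K n h × Grass K n k), IsOpenInGrassProd U ∧ U.Nonempty ∧
    ∀ L ∈ U, p L.1 L.2

end Generic

/-! ### Homogeneous polynomials and linear substitution. -/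

section Homogeneous

variable {K : Type*} [Field K]

/-! View `Vec K n` as a `K`-algebra under coordinatewise multiplication, so that the Hadamard
product is multiplication of coordinate vectors. The generic condition on the two linear subspaces
is linear disjointness: for bases `a` of one and `b` of the other, the products `a i * b j` are
linearly independent. This is a non-vanishing condition on maximal minors, hence open
(`isOpenInGrassProd_linearDisjoint`), and an explicit pair satisfies it
(`exists_linearDisjoint_grass`).

Given parameterizations `f` and `g` of a disjoint pair, some linear automorphism `T` sends the Segre
coordinate vector of index `(i, j)` to `f eᵢ * g eⱼ`. By bilinearity `T (segreVec n y z) = f y * g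
z` for all `y` and `z` (`exists_linearEquiv_segreVec_eq_mul`), so multiplication of points is the
Segre embedding followed by a projective automorphism.

Everything then transfers from the Segre side. Products are defined because Segre vectors of
non-zero vectors are non-zero and `T` is injective. The set of products is a subvariety because
Segre images of products of subvarieties are (`IsSubvariety.segre_image`), so taking its closure
adds nothing. -/

theorem MvPolynomial.IsHomogeneous.eval_smul {σ : Type*} {F : MvPolynomial σ K} {d : ℕ}
    (hF : F.IsHomogeneous d) (c : K) (v : σ → K) :
    MvPolynomial.eval (c • v) F = c ^ d * MvPolynomial.eval v F := by
  rw [MvPolynomial.eval_eq, MvPolynomial.eval_eq, Finset.mul_sum]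
  refine Finset.sum_congr rfl fun s hs => ?_
  have hd : ∑ i ∈ s.support, s i = d := (hF.degree_eq_sum_deg_support hs).symm
  simp only [Pi.smul_apply, smul_eq_mul, mul_pow, Finset.prod_mul_distrib, Finset.prod_pow_eq_pow_sum,
    hd]
  ring

/-- The pullback of a polynomial along a linear map of coordinate spaces. -/
noncomputable def MvPolynomial.linearPullback {σ τ : Type*} [Fintype σ] [DecidableEq σ]
    (f : (σ → K) →ₗ[K] (τ → K)) (F : MvPolynomial τ K) : MvPolynomial σ K :=
  MvPolynomial.aeval (fun i => ∑ j, MvPolynomial.C (f (Pi.single j 1) i) * MvPolynomial.X j) F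

theorem MvPolynomial.eval_linearPullback {σ τ : Type*} [Fintype σ] [DecidableEq σ]
    (f : (σ → K) →ₗ[K] (τ → K)) (F : MvPolynomial τ K) (v : σ → K) :
    MvPolynomial.eval v (MvPolynomial.linearPullback f F) = MvPolynomial.eval (f v) F := by
  have hv : (fun i => ∑ j, f (Pi.single j 1) i * v j) = f v := by
    conv_rhs => rw [pi_eq_sum_univ' v, map_sum]
    ext i
    simp [mul_comm, Finset.sum_apply]
  rw [MvPolynomial.linearPullback, ← MvPolynomial.coe_aeval_eq_eval, RingHom.coe_coe,
    ← AlgHom.comp_apply, MvPolynomial.comp_aeval, ← hv, ← MvPolynomial.coe_aeval_eq_eval]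
  simp [map_sum]

theorem MvPolynomial.IsHomogeneous.linearPullback {σ τ : Type*} [Fintype σ] [DecidableEq σ]
    (f : (σ → K) →ₗ[K] (τ → K)) {F : MvPolynomial τ K} {d : ℕ} (hF : F.IsHomogeneous d) :
    (MvPolynomial.linearPullback f F).IsHomogeneous d := by
  have := hF.aeval (fun i => ∑ j, MvPolynomial.C (f (Pi.single j 1) i) * MvPolynomial.X j)
    (fun i => MvPolynomial.IsHomogeneous.sum _ _ 1
      fun j _ => MvPolynomial.isHomogeneous_C_mul_X _ j)
  rwa [one_mul] at this

end Homogeneous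

/-! ### Zariski topology: linear maps and irreducible sets. -/

section ZariskiTopology

variable {K : Type*} [Field K] {m n h k : ℕ}

theorem isClosed_iff_isProjAlgebraic {Z : Set (PSpace K n)} : IsClosed Z ↔ IsProjAlgebraic Z := by
  rw [← isOpen_compl_iff]
  change Zᶜᶜ ∈ {Z : Set (PSpace K n) | IsProjAlgebraic Z} ↔ _
  rw [compl_compl]
  rfl

theorem eval_rep_mk_eq_zero_iff {F : MvPolynomial (Fin (n + 1)) K} {d : ℕ}
    (hF : F.IsHomogeneous d) (v : Vec K n) (hv : v ≠ 0) :
    MvPolynomial.eval (Projectivization.mk K v hv).rep F = 0 ↔ MvPolynomial.eval v F = 0 := by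
  obtain ⟨a, ha⟩ := Projectivization.exists_smul_eq_mk_rep K v hv
  rw [← ha, Units.smul_def, hF.eval_smul]
  simp

theorem mk_mem_projZeros_iff {S : Set (MvPolynomial (Fin (n + 1)) K)}
    (hS : ∀ F ∈ S, ∃ d : ℕ, F.IsHomogeneous d) (v : Vec K n) (hv : v ≠ 0) :
    Projectivization.mk K v hv ∈ projZeros S ↔ ∀ F ∈ S, MvPolynomial.eval v F = 0 :=
  forall₂_congr fun F hF => eval_rep_mk_eq_zero_iff (hS F hF).choose_spec v hv

theorem preimage_map_projZeros (f : Vec K m →ₗ[K] Vec K n) (hf : Function.Injective f)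
    {S : Set (MvPolynomial (Fin (n + 1)) K)} (hS : ∀ F ∈ S, ∃ d : ℕ, F.IsHomogeneous d) :
    Projectivization.map f hf ⁻¹' projZeros S =
      projZeros (MvPolynomial.linearPullback f '' S) := by
  have hS' : ∀ F ∈ MvPolynomial.linearPullback f '' S, ∃ d : ℕ, F.IsHomogeneous d := by
    rintro _ ⟨F, hF, rfl⟩
    exact (hS F hF).imp fun d hd => hd.linearPullback f
  ext P
  induction P using Projectivization.ind with
  | h v hv =>
    rw [Set.mem_preimage, Projectivization.map_mk, mk_mem_projZeros_iff hS,
      mk_mem_projZeros_iff hS']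
    simp [MvPolynomial.eval_linearPullback]

/-- Closed sets pull back by substituting `f` into their equations. Conversely, substituting a
linear left inverse `r` of `f` extends equations from the source to the target; `r` need not be
injective, since only polynomials are pulled back along it. -/
theorem isInducing_projectivizationMap (f : Vec K m →ₗ[K] Vec K n) (hf : Function.Injective f) :
    Topology.IsInducing (Projectivization.map f hf) := by
  rw [Topology.isInducing_iff, TopologicalSpace.ext_iff_isClosed]
  intro Z
  rw [isClosed_induced_iff]
  constructor
  · intro hZ
    obtain ⟨S, hS, rfl⟩ := isClosed_iff_isProjAlgebraic.mp hZ
    obtain ⟨r, hr⟩ := f.exists_leftInverse_of_injective (LinearMap.ker_eq_bot.mpr hf)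
    have hS' : ∀ F ∈ MvPolynomial.linearPullback r '' S, ∃ d : ℕ, F.IsHomogeneous d := by
      rintro _ ⟨F, hF, rfl⟩
      exact (hS F hF).imp fun d hd => hd.linearPullback r
    refine ⟨projZeros (MvPolynomial.linearPullback r '' S),
      isClosed_iff_isProjAlgebraic.mpr ⟨_, hS', rfl⟩, ?_⟩
    ext P
    induction P using Projectivization.ind with
    | h v hv =>
      rw [Set.mem_preimage, Projectivization.map_mk, mk_mem_projZeros_iff hS',
        mk_mem_projZeros_iff hS]
      have hrv : r (f v) = v := LinearMap.congr_fun hr v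
      simp [MvPolynomial.eval_linearPullback, hrv]
  · rintro ⟨W, hW, rfl⟩
    obtain ⟨S, hS, rfl⟩ := isClosed_iff_isProjAlgebraic.mp hW
    rw [preimage_map_projZeros f hf hS]
    refine isClosed_iff_isProjAlgebraic.mpr ⟨_, ?_, rfl⟩
    rintro _ ⟨F, hF, rfl⟩
    exact (hS F hF).imp fun d hd => hd.linearPullback f

theorem continuous_projectivizationMap (f : Vec K m →ₗ[K] Vec K n) (hf : Function.Injective f) :
    Continuous (Projectivization.map f hf) :=
  (isInducing_projectivizationMap f hf).continuous

theorem Topology.IsInducing.isIrreducible_preimage {A B : Type*} [TopologicalSpace A]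
    [TopologicalSpace B] {f : A → B} (hf : Topology.IsInducing f) {t : Set B}
    (ht : IsIrreducible t) (htf : t ⊆ Set.range f) : IsIrreducible (f ⁻¹' t) := by
  constructor
  · obtain ⟨y, hy⟩ := ht.nonempty
    obtain ⟨x, rfl⟩ := htf hy
    exact ⟨x, hy⟩
  · intro u v hu hv hu' hv'
    obtain ⟨u, hu₀, rfl⟩ := hf.isOpen_iff.mp hu
    obtain ⟨v, hv₀, rfl⟩ := hf.isOpen_iff.mp hv
    obtain ⟨x, hx, hxu⟩ := hu'
    obtain ⟨y, hy, hyv⟩ := hv'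
    obtain ⟨z, hz, hzuv⟩ := ht.isPreirreducible u v hu₀ hv₀ ⟨f x, hx, hxu⟩ ⟨f y, hy, hyv⟩
    obtain ⟨w, rfl⟩ := htf hz
    exact ⟨w, hz, hzuv⟩

/-- The image of a product of irreducible sets under a separately continuous map is irreducible. -/
theorem IsIrreducible.image_prod_of_separately_continuous {A B C : Type*} [TopologicalSpace A]
    [TopologicalSpace B] [TopologicalSpace C] {s : Set A} {t : Set B} (hs : IsIrreducible s)
    (ht : IsIrreducible t) {f : A × B → C} (hf₁ : ∀ b, Continuous fun a => f (a, b))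
    (hf₂ : ∀ a, Continuous fun b => f (a, b)) : IsIrreducible (f '' s ×ˢ t) := by
  refine ⟨(hs.nonempty.prod ht.nonempty).image f, ?_⟩
  rintro u v hu hv ⟨_, ⟨⟨a, b⟩, ⟨ha, hb⟩, rfl⟩, hab⟩ ⟨_, ⟨⟨a', b'⟩, ⟨ha', hb'⟩, rfl⟩, hab'⟩
  -- First move the left factor: one `x` puts `(x, b)` over `u` and `(x, b')` over `v`. With `x`
  -- fixed, irreducibility of `t` then gives a common `y`. Joint continuity is never needed, which
  -- matters because the Zariski topology on a product is not the product topology.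
  obtain ⟨x, hx, hxu, hxv⟩ := hs.isPreirreducible _ _ (hu.preimage (hf₁ b)) (hv.preimage (hf₁ b'))
    ⟨a, ha, hab⟩ ⟨a', ha', hab'⟩
  obtain ⟨y, hy, hyu, hyv⟩ := ht.isPreirreducible _ _ (hu.preimage (hf₂ x)) (hv.preimage (hf₂ x))
    ⟨b, hb, hxu⟩ ⟨b', hb', hxv⟩
  exact ⟨f (x, y), ⟨(x, y), ⟨hx, hy⟩, rfl⟩, hyu, hyv⟩

theorem IsSubvariety.preimage_map {X : Set (PSpace K n)} (hX : IsSubvariety X)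
    (f : Vec K m →ₗ[K] Vec K n) (hf : Function.Injective f)
    (hXf : X ⊆ Set.range (Projectivization.map f hf)) :
    IsSubvariety (Projectivization.map f hf ⁻¹' X) :=
  ⟨hX.1.preimage (continuous_projectivizationMap f hf),
    (isInducing_projectivizationMap f hf).isIrreducible_preimage hX.2 hXf⟩

theorem IsSubvariety.image_map {X : Set (PSpace K n)} (hX : IsSubvariety X)
    (g : Vec K n ≃ₗ[K] Vec K n) :
    IsSubvariety (Projectivization.map (g : Vec K n →ₗ[K] Vec K n) g.injective '' X) := by
  refine ⟨?_, hX.2.image _ (continuous_projectivizationMap _ _).continuousOn⟩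
  have h1 : ∀ P, Projectivization.map (g.symm : Vec K n →ₗ[K] Vec K n) g.symm.injective
      (Projectivization.map (g : Vec K n →ₗ[K] Vec K n) g.injective P) = P := by
    intro P
    induction P using Projectivization.ind with
    | h v hv => simp [Projectivization.map_mk]
  have h2 : ∀ P, Projectivization.map (g : Vec K n →ₗ[K] Vec K n) g.injective
      (Projectivization.map (g.symm : Vec K n →ₗ[K] Vec K n) g.symm.injective P) = P := by
    intro P
    induction P using Projectivization.ind with
    | h v hv => simp [Projectivization.map_mk]
  rw [Set.image_eq_preimage_of_inverse h1 h2]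
  exact hX.1.preimage (continuous_projectivizationMap _ _)

theorem Grass.points_subset_range_map {d : ℕ} (L : Grass K n d) (f : Vec K m →ₗ[K] Vec K n)
    (hf : Function.Injective f) (hfL : LinearMap.range f = L.1) :
    L.points ⊆ Set.range (Projectivization.map f hf) := by
  intro P hP
  induction P using Projectivization.ind with
  | h v hv =>
    have hvL : v ∈ L.1 := hP (by simp [Projectivization.submodule_mk, Submodule.mem_span_singleton_self])
    rw [← hfL] at hvL
    obtain ⟨w, rfl⟩ := hvL
    exact ⟨Projectivization.mk K w (by rintro rfl; simp at hv), Projectivization.map_mk _ _ _ _⟩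

end ZariskiTopology

/-! ### The Segre embedding and images of products of subvarieties. -/

section Segre

variable {K : Type*} [Field K] {n h k : ℕ}

/-- The coordinate of the ambient space of the Segre embedding belonging to a pair of indices. -/
def segreIndex (hn : (h + 1) * (k + 1) ≤ n + 1) (p : Fin (h + 1) × Fin (k + 1)) : Fin (n + 1) :=
  Fin.castLE hn (finProdFinEquiv p)

theorem segreIndex_injective (hn : (h + 1) * (k + 1) ≤ n + 1) :
    Function.Injective (segreIndex hn) :=
  (Fin.castLE_injective hn).comp finProdFinEquiv.injective

theorem segreVec_segreIndex (hn : (h + 1) * (k + 1) ≤ n + 1) (y : Vec K h) (z : Vec K k)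
    (p : Fin (h + 1) × Fin (k + 1)) : segreVec n y z (segreIndex hn p) = y p.1 * z p.2 := by
  have hp : ((segreIndex hn p : Fin (n + 1)) : ℕ) < (h + 1) * (k + 1) := (finProdFinEquiv p).2
  have hp' : (⟨segreIndex hn p, hp⟩ : Fin ((h + 1) * (k + 1))) = finProdFinEquiv p := rfl
  rw [segreVec, dif_pos hp, hp', Equiv.symm_apply_apply]

theorem segreVec_of_le (y : Vec K h) (z : Vec K k) {t : Fin (n + 1)}
    (ht : (h + 1) * (k + 1) ≤ t) : segreVec n y z t = 0 := by
  simp [segreVec, ht]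

theorem exists_segreIndex_eq (hn : (h + 1) * (k + 1) ≤ n + 1) {t : Fin (n + 1)}
    (ht : (t : ℕ) < (h + 1) * (k + 1)) : ∃ p, segreIndex hn p = t :=
  ⟨finProdFinEquiv.symm ⟨t, ht⟩, by rw [segreIndex, Equiv.apply_symm_apply]; rfl⟩

/-- The bilinear map underlying the Segre embedding. -/
def segreLinear (K : Type*) [Field K] (n h k : ℕ) : Vec K h →ₗ[K] Vec K k →ₗ[K] Vec K n :=
  LinearMap.mk₂ K (segreVec n)
    (fun y y' z => by ext t; simp only [segreVec, Pi.add_apply]; split_ifs <;> ring)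
    (fun c y z => by
      ext t; simp only [segreVec, Pi.smul_apply, smul_eq_mul]; split_ifs <;> ring)
    (fun y z z' => by ext t; simp only [segreVec, Pi.add_apply]; split_ifs <;> ring)
    (fun c y z => by
      ext t; simp only [segreVec, Pi.smul_apply, smul_eq_mul]; split_ifs <;> ring)

theorem segreLinear_apply (y : Vec K h) (z : Vec K k) :
    segreLinear K n h k y z = segreVec n y z := rfl

theorem segre_mk (hn : (h + 1) * (k + 1) ≤ n + 1) (y : Vec K h) (z : Vec K k) (hy : y ≠ 0)
    (hz : z ≠ 0) :
    segre hn (Projectivization.mk K y hy, Projectivization.mk K z hz) =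
      Projectivization.mk K (segreVec n y z) (segreVec_ne_zero hn hy hz) := by
  obtain ⟨a, ha⟩ := Projectivization.exists_smul_eq_mk_rep K y hy
  obtain ⟨b, hb⟩ := Projectivization.exists_smul_eq_mk_rep K z hz
  rw [segre, Projectivization.mk_eq_mk_iff]
  refine ⟨a * b, ?_⟩
  simp only [← ha, ← hb, ← segreLinear_apply, Units.smul_def, map_smul, LinearMap.smul_apply,
    smul_smul, Units.val_mul, mul_comm]

/-- With one factor fixed, the Segre embedding is induced by an injective linear map. -/
theorem segre_left_continuous (hn : (h + 1) * (k + 1) ≤ n + 1) (Q : PSpace K k) :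
    Continuous fun P : PSpace K h => segre hn (P, Q) := by
  have hinj : Function.Injective ((segreLinear K n h k).flip Q.rep) := by
    rw [injective_iff_map_eq_zero]
    intro y hy
    by_contra hy0
    exact segreVec_ne_zero hn hy0 Q.rep_nonzero hy
  convert continuous_projectivizationMap _ hinj using 1
  ext1 P
  induction P using Projectivization.ind with
  | h y hy =>
    conv_lhs => rw [← Q.mk_rep]
    rw [segre_mk, Projectivization.map_mk]
    rfl

theorem segre_right_continuous (hn : (h + 1) * (k + 1) ≤ n + 1) (P : PSpace K h) :
    Continuous fun Q : PSpace K k => segre hn (P, Q) := by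
  have hinj : Function.Injective (segreLinear K n h k P.rep) := by
    rw [injective_iff_map_eq_zero]
    intro z hz
    by_contra hz0
    exact segreVec_ne_zero hn P.rep_nonzero hz0 hz
  convert continuous_projectivizationMap _ hinj using 1
  ext1 Q
  induction Q using Projectivization.ind with
  | h z hz =>
    conv_lhs => rw [← P.mk_rep]
    rw [segre_mk, Projectivization.map_mk]
    rfl

/-- A vector is in the image of the Segre map if its entries form a matrix of rank one. -/
theorem exists_segreVec_eq (hn : (h + 1) * (k + 1) ≤ n + 1) {v : Vec K n} (hv : v ≠ 0)
    (hv0 : ∀ t : Fin (n + 1), (h + 1) * (k + 1) ≤ t → v t = 0)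
    (hminor : ∀ i i' j j', v (segreIndex hn (i, j)) * v (segreIndex hn (i', j')) =
      v (segreIndex hn (i, j')) * v (segreIndex hn (i', j))) :
    ∃ (y : Vec K h) (z : Vec K k), y ≠ 0 ∧ z ≠ 0 ∧ segreVec n y z = v := by
  obtain ⟨t, ht⟩ := Function.ne_iff.mp hv
  obtain ⟨⟨i₀, j₀⟩, rfl⟩ := exists_segreIndex_eq hn (lt_of_not_ge fun h => ht (hv0 t h))
  -- With a non-zero entry at `(i₀, j₀)` as pivot, a rank-one matrix is its column `j₀` times its
  -- row `i₀` divided by the pivot.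
  have heq : segreVec n (fun i => v (segreIndex hn (i, j₀)))
      (fun j => (v (segreIndex hn (i₀, j₀)))⁻¹ * v (segreIndex hn (i₀, j))) = v := by
    ext t
    by_cases ht' : (t : ℕ) < (h + 1) * (k + 1)
    · obtain ⟨⟨i, j⟩, rfl⟩ := exists_segreIndex_eq hn ht'
      rw [segreVec_segreIndex]
      have := hminor i i₀ j j₀
      rw [Pi.zero_apply] at ht
      field_simp
      linear_combination -this
    · rw [segreVec_of_le _ _ (not_lt.mp ht'), hv0 t (not_lt.mp ht')]
  refine ⟨_, _, ?_, ?_, heq⟩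
  · intro h0
    exact ht (congrFun h0 i₀)
  · intro h0
    have := congrFun h0 j₀
    simp only [Pi.zero_apply] at this ht
    simp [ht] at this

/-- The equations say that the trailing coordinates vanish (`E₁`), the 2×2 minors vanish (`E₂`),
each column satisfies the equations of `X` (`E₃`) and each row those of `Y` (`E₄`). Columns of the
matrix of `y` and `z` are multiples `z j • y`, at least one of them non-zero, so by homogeneity `E₃`
holds exactly when `y` lies over `X`; likewise for rows. -/
theorem isClosed_segre_image (hn : (h + 1) * (k + 1) ≤ n + 1) {X : Set (PSpace K h)}
    {Y : Set (PSpace K k)} (hX : IsClosed X) (hY : IsClosed Y) :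
    IsClosed (segre hn '' X ×ˢ Y) := by
  obtain ⟨S, hS, rfl⟩ := isClosed_iff_isProjAlgebraic.mp hX
  obtain ⟨T, hT, rfl⟩ := isClosed_iff_isProjAlgebraic.mp hY
  let x : Fin (h + 1) → Fin (k + 1) → MvPolynomial (Fin (n + 1)) K :=
    fun i j => MvPolynomial.X (segreIndex hn (i, j))
  let E₁ : Set (MvPolynomial (Fin (n + 1)) K) :=
    {F | ∃ t : Fin (n + 1), (h + 1) * (k + 1) ≤ t ∧ F = MvPolynomial.X t}
  let E₂ : Set (MvPolynomial (Fin (n + 1)) K) :=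
    {F | ∃ i i' j j', F = x i j * x i' j' - x i j' * x i' j}
  let E₃ : Set (MvPolynomial (Fin (n + 1)) K) :=
    {F | ∃ G ∈ S, ∃ j, F = MvPolynomial.rename (fun i => segreIndex hn (i, j)) G}
  let E₄ : Set (MvPolynomial (Fin (n + 1)) K) :=
    {F | ∃ G ∈ T, ∃ i, F = MvPolynomial.rename (fun j => segreIndex hn (i, j)) G}
  have hE : ∀ F ∈ E₁ ∪ E₂ ∪ E₃ ∪ E₄, ∃ d : ℕ, F.IsHomogeneous d := by
    rintro F (((⟨t, -, rfl⟩ | ⟨i, i', j, j', rfl⟩) | ⟨G, hG, j, rfl⟩) | ⟨G, hG, i, rfl⟩)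
    · exact ⟨1, MvPolynomial.isHomogeneous_X _ _⟩
    · exact ⟨1 + 1, ((MvPolynomial.isHomogeneous_X _ _).mul (MvPolynomial.isHomogeneous_X _ _)).sub
        ((MvPolynomial.isHomogeneous_X _ _).mul (MvPolynomial.isHomogeneous_X _ _))⟩
    · exact (hS G hG).imp fun d hd => hd.rename_isHomogeneous
    · exact (hT G hG).imp fun d hd => hd.rename_isHomogeneous
  have hcol : ∀ (y : Vec K h) (z : Vec K k) (j : Fin (k + 1)),
      segreVec n y z ∘ (fun i => segreIndex hn (i, j)) = z j • y := by
    intro y z j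
    ext i
    simp [segreVec_segreIndex, mul_comm]
  have hrow : ∀ (y : Vec K h) (z : Vec K k) (i : Fin (h + 1)),
      segreVec n y z ∘ (fun j => segreIndex hn (i, j)) = y i • z := by
    intro y z j
    ext i
    simp [segreVec_segreIndex]
  refine isClosed_iff_isProjAlgebraic.mpr ⟨E₁ ∪ E₂ ∪ E₃ ∪ E₄, hE, ?_⟩
  ext R
  constructor
  · rintro ⟨⟨P, Q⟩, ⟨hP, hQ⟩, rfl⟩
    rw [segre, mk_mem_projZeros_iff hE]
    rintro F (((⟨t, ht, rfl⟩ | ⟨i, i', j, j', rfl⟩) | ⟨G, hG, j, rfl⟩) | ⟨G, hG, i, rfl⟩)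
    · simp [segreVec_of_le _ _ ht]
    · simp only [x, map_sub, map_mul, MvPolynomial.eval_X, segreVec_segreIndex]
      ring
    · rw [MvPolynomial.eval_rename, hcol, (hS G hG).choose_spec.eval_smul, hP G hG, mul_zero]
    · rw [MvPolynomial.eval_rename, hrow, (hT G hG).choose_spec.eval_smul, hQ G hG, mul_zero]
  · induction R using Projectivization.ind with
    | h v hv =>
      rw [mk_mem_projZeros_iff hE]
      intro hR
      obtain ⟨y, z, hy, hz, rfl⟩ := exists_segreVec_eq hn hv
        (fun t ht => by simpa using hR _ (Or.inl (Or.inl (Or.inl ⟨t, ht, rfl⟩))))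
        (fun i i' j j' => by
          simpa [x, sub_eq_zero] using hR _ (Or.inl (Or.inl (Or.inr ⟨i, i', j, j', rfl⟩))))
      refine ⟨(Projectivization.mk K y hy, Projectivization.mk K z hz), ⟨?_, ?_⟩,
        segre_mk hn y z hy hz⟩
      · rw [mk_mem_projZeros_iff hS]
        intro G hG
        obtain ⟨j, hj⟩ := Function.ne_iff.mp hz
        have := hR _ (Or.inl (Or.inr ⟨G, hG, j, rfl⟩))
        rw [MvPolynomial.eval_rename, hcol, (hS G hG).choose_spec.eval_smul] at this
        exact (mul_eq_zero.mp this).resolve_left (pow_ne_zero _ hj)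
      · rw [mk_mem_projZeros_iff hT]
        intro G hG
        obtain ⟨i, hi⟩ := Function.ne_iff.mp hy
        have := hR _ (Or.inr ⟨G, hG, i, rfl⟩)
        rw [MvPolynomial.eval_rename, hrow, (hT G hG).choose_spec.eval_smul] at this
        exact (mul_eq_zero.mp this).resolve_left (pow_ne_zero _ hi)

theorem IsSubvariety.segre_image (hn : (h + 1) * (k + 1) ≤ n + 1) {X : Set (PSpace K h)}
    {Y : Set (PSpace K k)} (hX : IsSubvariety X) (hY : IsSubvariety Y) :
    IsSubvariety (segre hn '' X ×ˢ Y) :=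
  ⟨isClosed_segre_image hn hX.1 hY.1,
    hX.2.image_prod_of_separately_continuous hY.2 (segre_left_continuous hn)
      (segre_right_continuous hn)⟩

end Segre

/-! ### Extension of isomorphisms, minors, linear disjointness. -/

section LinearAlgebra

variable {K : Type*} [Field K]

/-- A linearly independent family maps to another one under some linear automorphism. -/
theorem LinearIndependent.exists_linearEquiv_apply_eq {V ι : Type*} [AddCommGroup V] [Module K V]
    [Finite ι] {v w : ι → V} (hv : LinearIndependent K v) (hw : LinearIndependent K w) :
    ∃ g : V ≃ₗ[K] V, ∀ i, g (v i) = w i := by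
  have : FiniteDimensional K (Submodule.span K (Set.range v)) :=
    FiniteDimensional.span_of_finite K (Set.finite_range v)
  -- The isomorphism of the two finite-dimensional spans matching their bases extends to the whole
  -- space.
  obtain ⟨g, hg⟩ := Submodule.exists_linearEquiv_restrict_eq
    ((Module.Basis.span hv).equiv (Module.Basis.span hw) (Equiv.refl ι))
  refine ⟨g, fun i => ?_⟩
  have := hg (Module.Basis.span hv i)
  rw [Module.Basis.equiv_apply, Module.Basis.span_apply, Module.Basis.span_apply] at this
  exact this.symm

/-- A family of vectors is linearly independent if and only if some maximal minor of the matrix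
of their coordinates does not vanish. -/
theorem linearIndependent_iff_exists_det_ne_zero {ι τ : Type*} [Fintype ι] [DecidableEq ι]
    [Finite τ] (v : ι → τ → K) :
    LinearIndependent K v ↔ ∃ e : ι → τ, (Matrix.of fun i j => v i (e j)).det ≠ 0 := by
  have := Fintype.ofFinite τ
  constructor
  · intro hv
    -- Select columns forming a basis of the column space; as row rank equals column rank, there are
    -- exactly `Fintype.card ι` of them, giving an invertible square submatrix.
    obtain ⟨κ, a, ha, hspan, hli⟩ := exists_linearIndependent' K (Matrix.of v).col
    have : Finite κ := Finite.of_injective a ha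
    have := Fintype.ofFinite κ
    have hcard : Fintype.card κ = Fintype.card ι := by
      rw [← LinearIndependent.rank_matrix (M := Matrix.of v) hv, Matrix.rank_eq_finrank_span_cols,
        ← hspan, finrank_span_eq_card hli]
    let e := Fintype.equivOfCardEq hcard
    refine ⟨a ∘ e.symm, ?_⟩
    rw [← isUnit_iff_ne_zero, ← Matrix.isUnit_iff_isUnit_det,
      ← Matrix.linearIndependent_cols_iff_isUnit]
    exact hli.comp e.symm e.symm.injective
  · rintro ⟨e, he⟩
    have h := Matrix.linearIndependent_rows_of_det_ne_zero he
    exact LinearIndependent.of_comp (LinearMap.funLeft K K e) h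

/-- Passing to linear disjointness makes independence of the products a property of the two spans
alone, so it defines a subset of the product of Grassmannians that can be tested on any frames. -/
theorem linearDisjoint_span_iff {A ι κ : Type*} [CommRing A] [Algebra K A]
    {a : ι → A} {b : κ → A} (ha : LinearIndependent K a) (hb : LinearIndependent K b) :
    (Submodule.span K (Set.range a)).LinearDisjoint (Submodule.span K (Set.range b)) ↔
      LinearIndependent K fun p : ι × κ => a p.1 * b p.2 := by
  constructor
  · intro H
    simpa [Module.Basis.span_apply] using H.linearIndependent_mul_of_flat_left
      (Module.Basis.span ha).linearIndependent (Module.Basis.span hb).linearIndependent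
  · intro H
    exact Submodule.LinearDisjoint.of_basis_mul _ _ (Module.Basis.span ha) (Module.Basis.span hb)
      (by simpa [Module.Basis.span_apply] using H)

end LinearAlgebra

/-! ### Linear disjointness is a non-empty open condition. -/

section Generic

variable {K : Type*} [Field K] {n h k : ℕ}

theorem isOpenInGrassProd_linearDisjoint :
    IsOpenInGrassProd {L : Grass K n h × Grass K n k | L.1.1.LinearDisjoint L.2.1} := by
  -- The maximal minors of the matrix with rows `a i * b j`. The column choice `e` may repeat
  -- columns; such minors are zero and do no harm.
  refine ⟨Set.range fun e : Fin (h + 1) × Fin (k + 1) → Fin (n + 1) =>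
    (Matrix.of fun p q : Fin (h + 1) × Fin (k + 1) =>
      (MvPolynomial.X (Sum.inl (p.1, e q)) * MvPolynomial.X (Sum.inr (p.2, e q)) :
        MvPolynomial ((Fin (h + 1) × Fin (n + 1)) ⊕ (Fin (k + 1) × Fin (n + 1))) K)).det, ?_⟩
  intro a b ha hb
  refine (linearDisjoint_span_iff ha hb).trans
    ((linearIndependent_iff_exists_det_ne_zero _).trans ?_)
  rw [Set.exists_range_iff]
  refine exists_congr fun e => ?_
  rw [RingHom.map_det]
  refine iff_of_eq (congrArg (fun M : Matrix _ _ K => M.det ≠ 0) ?_)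
  ext p q
  simp

/-- Arrange the Segre coordinates as a matrix: `a i` is the indicator of row `i` and `b j` that of
column `j`, so `a i * b j` is the unit vector at `(i, j)`. -/
theorem exists_linearDisjoint_grass (hn : (h + 1) * (k + 1) ≤ n + 1) :
    {L : Grass K n h × Grass K n k | L.1.1.LinearDisjoint L.2.1}.Nonempty := by
  let a : Fin (h + 1) → Vec K n := fun i => segreVec n (Pi.single i 1 : Vec K h) (1 : Vec K k)
  let b : Fin (k + 1) → Vec K n := fun j => segreVec n (1 : Vec K h) (Pi.single j 1 : Vec K k)
  have hab : ∀ p : Fin (h + 1) × Fin (k + 1), a p.1 * b p.2 = Pi.single (segreIndex hn p) 1 := by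
    rintro ⟨i, j⟩
    ext t
    by_cases ht : (t : ℕ) < (h + 1) * (k + 1)
    · obtain ⟨⟨i', j'⟩, rfl⟩ := exists_segreIndex_eq hn ht
      simp only [a, b, Pi.mul_apply, segreVec_segreIndex, Pi.single_apply, Pi.one_apply, mul_one,
        one_mul, (segreIndex_injective hn).eq_iff, Prod.mk.injEq]
      split_ifs <;> simp_all
    · have h0 : t ≠ segreIndex hn (i, j) := by
        rintro rfl
        exact ht (finProdFinEquiv (i, j)).2
      simp [a, segreVec_of_le _ _ (not_lt.mp ht), h0]
  have hli : LinearIndependent K fun p : Fin (h + 1) × Fin (k + 1) => a p.1 * b p.2 := by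
    simp_rw [hab]
    exact (Pi.linearIndependent_single_one (Fin (n + 1)) K).comp _ (segreIndex_injective hn)
  -- Multiplication by `b 0` is linear and sends `a` to a subfamily of the independent products.
  have ha : LinearIndependent K a :=
    LinearIndependent.of_comp (LinearMap.mulRight K (b 0))
      (hli.comp (fun i => (i, 0)) fun i i' hi => (Prod.mk.inj hi).1)
  have hb : LinearIndependent K b :=
    LinearIndependent.of_comp (LinearMap.mulLeft K (a 0))
      (hli.comp (fun j => (0, j)) fun i i' hi => (Prod.mk.inj hi).2)
  exact ⟨(Grass.ofFrame a ha, Grass.ofFrame b hb), (linearDisjoint_span_iff ha hb).mpr hli⟩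

end Generic

/-! ### Hadamard products as linear images of Segre varieties. -/

section Main

variable {K : Type*} [Field K] {n h k : ℕ}

theorem exists_linearEquiv_segreVec_eq_mul (hn : (h + 1) * (k + 1) ≤ n + 1)
    (f : Vec K h →ₗ[K] Vec K n) (g : Vec K k →ₗ[K] Vec K n)
    (hf : Function.Injective f) (hg : Function.Injective g)
    (hfg : (LinearMap.range f).LinearDisjoint (LinearMap.range g)) :
    ∃ T : Vec K n ≃ₗ[K] Vec K n, ∀ y z, T (segreVec n y z) = f y * g z := by
  have hli : LinearIndependent K fun p : Fin (h + 1) × Fin (k + 1) =>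
      f (Pi.single p.1 1) * g (Pi.single p.2 1) := by
    have hf' := (Pi.linearIndependent_single_one (Fin (h + 1)) K).map' f
      (LinearMap.ker_eq_bot.mpr hf)
    have hg' := (Pi.linearIndependent_single_one (Fin (k + 1)) K).map' g
      (LinearMap.ker_eq_bot.mpr hg)
    refine hfg.linearIndependent_mul_of_flat_left
      (m := fun i => f.rangeRestrict (Pi.single i 1)) (n := fun j => g.rangeRestrict (Pi.single j 1))
      (LinearIndependent.of_comp (Submodule.subtype _) hf')
      (LinearIndependent.of_comp (Submodule.subtype _) hg')
  obtain ⟨T, hT⟩ := LinearIndependent.exists_linearEquiv_apply_eq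
    ((Pi.linearIndependent_single_one (Fin (n + 1)) K).comp _ (segreIndex_injective hn)) hli
  refine ⟨T, fun y z => ?_⟩
  -- Both sides are bilinear in `(y, z)`, so agreement on pairs of standard basis vectors, which is
  -- how `T` was chosen, suffices.
  have hB : (segreLinear K n h k).compr₂ (T : Vec K n →ₗ[K] Vec K n) =
      (LinearMap.mul K (Vec K n)).compl₁₂ f g := by
    refine LinearMap.pi_ext' fun i => LinearMap.ext_ring (LinearMap.pi_ext' fun j =>
      LinearMap.ext_ring ?_)
    have hs : segreVec n (Pi.single i 1 : Vec K h) (Pi.single j 1 : Vec K k) =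
        Pi.single (segreIndex hn (i, j)) 1 := by
      ext t
      by_cases ht : (t : ℕ) < (h + 1) * (k + 1)
      · obtain ⟨⟨i', j'⟩, rfl⟩ := exists_segreIndex_eq hn ht
        simp only [segreVec_segreIndex, Pi.single_apply, (segreIndex_injective hn).eq_iff,
          Prod.mk.injEq]
        split_ifs <;> simp_all
      · have h0 : t ≠ segreIndex hn (i, j) := by
          rintro rfl
          exact ht (finProdFinEquiv (i, j)).2
        simp [segreVec_of_le _ _ (not_lt.mp ht), h0]
    simpa [segreLinear_apply, hs] using hT (i, j)
  exact LinearMap.congr_fun₂ hB y z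

theorem hadamardDefined_mk_iff (v w : Vec K n) (hv : v ≠ 0) (hw : w ≠ 0) :
    HadamardDefined (Projectivization.mk K v hv) (Projectivization.mk K w hw) ↔ v * w ≠ 0 := by
  obtain ⟨a, ha⟩ := Projectivization.exists_smul_eq_mk_rep K v hv
  obtain ⟨b, hb⟩ := Projectivization.exists_smul_eq_mk_rep K w hw
  rw [HadamardDefined, ← ha, ← hb, smul_mul_smul_comm, Units.smul_def, Ne, Ne, smul_eq_zero]
  simp

theorem hadamardPoint_mk (v w : Vec K n) (hv : v ≠ 0) (hw : w ≠ 0)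
    (H : HadamardDefined (Projectivization.mk K v hv) (Projectivization.mk K w hw)) :
    hadamardPoint (Projectivization.mk K v hv) (Projectivization.mk K w hw) H =
      Projectivization.mk K (v * w) ((hadamardDefined_mk_iff v w hv hw).mp H) := by
  obtain ⟨a, ha⟩ := Projectivization.exists_smul_eq_mk_rep K v hv
  obtain ⟨b, hb⟩ := Projectivization.exists_smul_eq_mk_rep K w hw
  refine (Projectivization.mk_eq_mk_iff K _ _ _ _).mpr ⟨a * b, ?_⟩
  rw [← ha, ← hb, smul_mul_smul_comm]

theorem map_segre_eq_hadamardPoint (hn : (h + 1) * (k + 1) ≤ n + 1)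
    {f : Vec K h →ₗ[K] Vec K n} {g : Vec K k →ₗ[K] Vec K n}
    (hf : Function.Injective f) (hg : Function.Injective g) {T : Vec K n ≃ₗ[K] Vec K n}
    (hT : ∀ y z, T (segreVec n y z) = f y * g z) (P : PSpace K h) (Q : PSpace K k) :
    ∃ H : HadamardDefined (Projectivization.map f hf P) (Projectivization.map g hg Q),
      Projectivization.map (T : Vec K n →ₗ[K] Vec K n) T.injective (segre hn (P, Q)) =
        hadamardPoint (Projectivization.map f hf P) (Projectivization.map g hg Q) H := by
  induction P using Projectivization.ind with
  | h y hy =>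
    induction Q using Projectivization.ind with
    | h z hz =>
      have H : HadamardDefined (Projectivization.map f hf (Projectivization.mk K y hy))
          (Projectivization.map g hg (Projectivization.mk K z hz)) := by
        rw [Projectivization.map_mk, Projectivization.map_mk, hadamardDefined_mk_iff, ← hT]
        exact (map_ne_zero_iff T T.injective).mpr (segreVec_ne_zero hn hy hz)
      refine ⟨H, ?_⟩
      simp only [Projectivization.map_mk, segre_mk, hadamardPoint_mk]
      simp [hT]

theorem hadamard_of_linearDisjoint (hn : (h + 1) * (k + 1) ≤ n + 1)
    (f : Vec K h →ₗ[K] Vec K n) (g : Vec K k →ₗ[K] Vec K n)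
    (hf : Function.Injective f) (hg : Function.Injective g)
    (hfg : (LinearMap.range f).LinearDisjoint (LinearMap.range g)) {X Y : Set (PSpace K n)}
    (hX : IsSubvariety X) (hY : IsSubvariety Y)
    (hXf : X ⊆ Set.range (Projectivization.map f hf))
    (hYg : Y ⊆ Set.range (Projectivization.map g hg)) :
    ProjectivelyEquivalent
        (segre hn '' ((Projectivization.map f hf ⁻¹' X) ×ˢ (Projectivization.map g hg ⁻¹' Y)))
        (hadamardProduct X Y) ∧
      (∀ P ∈ X, ∀ Q ∈ Y, HadamardDefined P Q) ∧ hadamardProduct X Y = hadamardPoints X Y := by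
  obtain ⟨T, hT⟩ := exists_linearEquiv_segreVec_eq_mul hn f g hf hg hfg
  have hsegre := IsSubvariety.segre_image hn (hX.preimage_map f hf hXf) (hY.preimage_map g hg hYg)
  have himage : Projectivization.map (T : Vec K n →ₗ[K] Vec K n) T.injective ''
      (segre hn '' ((Projectivization.map f hf ⁻¹' X) ×ˢ (Projectivization.map g hg ⁻¹' Y))) =
      hadamardPoints X Y := by
    ext R
    constructor
    · rintro ⟨_, ⟨⟨P, Q⟩, ⟨hP, hQ⟩, rfl⟩, rfl⟩
      obtain ⟨H, hH⟩ := map_segre_eq_hadamardPoint hn hf hg hT P Q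
      exact ⟨_, hP, _, hQ, H, hH⟩
    · rintro ⟨P', hP, Q', hQ, H, rfl⟩
      obtain ⟨P, rfl⟩ := hXf hP
      obtain ⟨Q, rfl⟩ := hYg hQ
      exact ⟨_, ⟨(P, Q), ⟨hP, hQ⟩, rfl⟩, (map_segre_eq_hadamardPoint hn hf hg hT P Q).choose_spec⟩
  have hsub : IsSubvariety (hadamardPoints X Y) := himage ▸ hsegre.image_map T
  have hclosure : hadamardProduct X Y = hadamardPoints X Y := hsub.1.closure_eq
  refine ⟨⟨hsegre, hclosure ▸ hsub, T, himage.trans hclosure.symm⟩, ?_, hclosure⟩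
  intro P' hP Q' hQ
  obtain ⟨P, rfl⟩ := hXf hP
  obtain ⟨Q, rfl⟩ := hYg hQ
  exact (map_segre_eq_hadamardPoint hn hf hg hT P Q).choose

theorem Grass.exists_parametrization {d : ℕ} (L : Grass K n d) :
    ∃ f : Vec K d →ₗ[K] Vec K n, Function.Injective f ∧ LinearMap.range f = L.1 := by
  have e : Vec K d ≃ₗ[K] L.1 := LinearEquiv.ofFinrankEq _ _ (by rw [L.2]; simp)
  exact ⟨L.1.subtype ∘ₗ e, L.1.injective_subtype.comp e.injective, by
    rw [LinearMap.range_comp, LinearEquiv.range, Submodule.map_top, Submodule.range_subtype]⟩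

end Main

theorem mainTheorem1 {K : Type*} [Field K] [IsAlgClosed K] [CharZero K] (n h k : ℕ)
    (hn : (h + 1) * (k + 1) ≤ n + 1) :
    ForGenericPair fun (Lh : Grass K n h) (Lk : Grass K n k) =>
      ∀ X Y : Set (PSpace K n), IsSubvariety X → IsSubvariety Y →
        X ⊆ Lh.points → Y ⊆ Lk.points →
        -- for all parameterizations `f` of `Lh` and `g` of `Lk`
        (∀ (f : Vec K h →ₗ[K] Vec K n) (g : Vec K k →ₗ[K] Vec K n)
          (hf : Function.Injective f) (hg : Function.Injective g),
          LinearMap.range f = Lh.1 → LinearMap.range g = Lk.1 →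
          ProjectivelyEquivalent
            (segre hn '' ((Projectivization.map f hf ⁻¹' X) ×ˢ (Projectivization.map g hg ⁻¹' Y)))
            (hadamardProduct X Y)) ∧
        (∀ P ∈ X, ∀ Q ∈ Y, HadamardDefined P Q) ∧
        hadamardProduct X Y = hadamardPoints X Y := by
  refine ⟨{L | L.1.1.LinearDisjoint L.2.1}, isOpenInGrassProd_linearDisjoint,
    exists_linearDisjoint_grass hn, ?_⟩
  rintro ⟨Lh, Lk⟩ hL X Y hX hY hXL hYL
  have key : ∀ (f : Vec K h →ₗ[K] Vec K n) (g : Vec K k →ₗ[K] Vec K n)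
      (hf : Function.Injective f) (hg : Function.Injective g),
      LinearMap.range f = Lh.1 → LinearMap.range g = Lk.1 → _ :=
    fun f g hf hg hfL hgL => hadamard_of_linearDisjoint hn f g hf hg (by rw [hfL, hgL]; exact hL)
      hX hY (hXL.trans (Lh.points_subset_range_map f hf hfL))
      (hYL.trans (Lk.points_subset_range_map g hg hgL))
  -- The claims about definedness and closure mention no parameterization, so one must be supplied
  -- to deduce them.
  obtain ⟨f, hf, hfL⟩ := Lh.exists_parametrization
  obtain ⟨g, hg, hgL⟩ := Lk.exists_parametrization
  exact ⟨fun f g hf hg hfL hgL => (key f g hf hg hfL hgL).1, (key f g hf hg hfL hgL).2⟩
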